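/- Let $N>4$ be an integer and put $\alpha_{2,N}=\frac{N-1}{2}$. Consider, for twice continuously differentiable functions $z:\mathbb R\to\mathbb R$, the problem $$-z''+(N-4)z'+(2N-4)z=\alpha_{2,N}z^2\ \text{ on }\mathbb R,\qquad \lim_{t\to-\infty}e^tz(t)=0=\lim_{t\to+\infty}e^tz(t),\tag{1}$$ and the equivalent planar system $$z'=y,\qquad y'=(N-4)y+(2N-4)z-\alpha_{2,N}z^2,\tag{2}$$ with equilibria $(0,0)$ and $\gamma_1=\left(\frac{2N-4}{\alpha_{2,N}},0\right)$. Then problem (1) has a continuum of nontrivial positive solutions: the set of functions $z$ that solve (1) and satisfy $z\neq0$ and $z(t)>0$ for all $t\in\mathbb R$ has the cardinality of $\mathbb R$. More precisely: (i) The origin is a saddle of (2) (the eigenvalues of the linearization are real and of opposite signs), and $\gamma_1$ is a source of (2) (both eigenvalues of the linearization have positive real part); $\gamma_1$ is an unstable node (both eigenvalues real and positive) if and only if $N\ge 14$. (ii) There is a function $z:\mathbb R\to\mathbb R$ such that $t\mapsto(z(t),z'(t))$ is a heteroclinic orbit of (2) from $\gamma_1$ to the origin, that is, it solves (2) on $\mathbb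 R$, tends to $\gamma_1$ as $t\to-\infty$, and tends to $(0,0)$ as $t\to+\infty$. It decays like $e^{-2t}$: the limit $\lim_{t\to+\infty}e^{2t}z(t)$ exists and is a positive real number. (iii) For this $z$ and every $s\in\mathbb R$, the translate $z_s(t)=z(t+s)$ is a nontrivial positive solution of (1), and $w(t)=e^tz_s(t)$ is a $C^2$ solution of $$-w''+(N-2)w'+(N-1)w=\tfrac{N-1}{2}e^{-t}w^2\ \text{ on }\mathbb R,\qquad w(-\infty)=w(+\infty)=0.$$ The translates $z_s$, $s\in\mathbb R$, are pairwise different. -/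

import Mathlib

open Filter Topology Polynomial

noncomputable section

/-- The coefficient `α_{2,N} = (1/2) * binom (N-1) 1 = (N-1)/2`. -/
def alphaTwo (N : ℕ) : ℝ := ((N : ℝ) - 1) / 2

/-- `z` is a classical solution, defined on all of `ℝ`, of
`-z'' + (N-4) z' + (2N-4) z = ((N-1)/2) z²` with `e^t z(t) → 0` as `t → -∞` and as `t → +∞`. -/
structure IsEntireSolution (N : ℕ) (z : ℝ → ℝ) : Prop where
  contDiff : ContDiff ℝ 2 z
  eqn : ∀ t : ℝ, -deriv (deriv z) t + ((N : ℝ) - 4) * deriv z t + (2 * (N : ℝ) - 4) * z t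
    = alphaTwo N * z t ^ 2
  atBot : Tendsto (fun t : ℝ => Real.exp t * z t) atBot (𝓝 0)
  atTop : Tendsto (fun t : ℝ => Real.exp t * z t) atTop (𝓝 0)

/-- `w` is a classical solution, defined on all of `ℝ`, of the problem in the variable
`w = e^t z`: `-w'' + (N-2) w' + (N-1) w = ((N-1)/2) e^{-t} w²`, `w(-∞) = w(+∞) = 0`. -/
structure IsEntireSolutionW (N : ℕ) (w : ℝ → ℝ) : Prop where
  contDiff : ContDiff ℝ 2 w
  eqn : ∀ t : ℝ, -deriv (deriv w) t + ((N : ℝ) - 2) * deriv w t + ((N : ℝ) - 1) * w t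
    = alphaTwo N * Real.exp (-t) * w t ^ 2
  atBot : Tendsto w atBot (𝓝 0)
  atTop : Tendsto w atTop (𝓝 0)

/-- The nontrivial positive solutions. -/
def positiveEntireSolutions (N : ℕ) : Set (ℝ → ℝ) :=
  {z | IsEntireSolution N z ∧ z ≠ 0 ∧ ∀ t : ℝ, 0 < z t}

/-- The planar vector field `(z, y) ↦ (y, (N-4) y + (2N-4) z - α_{2,N} z²)` equivalent to the
equation under `y = z'`. -/
def planarField (N : ℕ) (p : ℝ × ℝ) : ℝ × ℝ :=
  (p.2, ((N : ℝ) - 4) * p.2 + (2 * (N : ℝ) - 4) * p.1 - alphaTwo N * p.1 ^ 2)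

/-- The equilibrium `γ₁ = ((2N-4)/α_{2,N}, 0)`. -/
def gammaOne (N : ℕ) : ℝ × ℝ := ((2 * (N : ℝ) - 4) / alphaTwo N, 0)

/-- `p` is an equilibrium of the differentiable-at-`p` vector field `F`. -/
def IsEquilibrium (F : ℝ × ℝ → ℝ × ℝ) (p : ℝ × ℝ) : Prop :=
  F p = 0 ∧ DifferentiableAt ℝ F p

/-- The characteristic polynomial of the linearization of `F` at `p`. -/
def linCharpoly (F : ℝ × ℝ → ℝ × ℝ) (p : ℝ × ℝ) : ℝ[X] :=
  ((fderiv ℝ F p : (ℝ × ℝ) →L[ℝ] (ℝ × ℝ)) : (ℝ × ℝ) →ₗ[ℝ] (ℝ × ℝ)).charpoly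

/-- Saddle: the eigenvalues of the linearization are real, of opposite (nonzero) signs. -/
def IsSaddle (F : ℝ × ℝ → ℝ × ℝ) (p : ℝ × ℝ) : Prop :=
  IsEquilibrium F p ∧ ∃ a b : ℝ, a < 0 ∧ 0 < b ∧ linCharpoly F p = (X - C a) * (X - C b)

/-- Source (repelling equilibrium): all complex eigenvalues of the linearization have positive
real part. -/
def IsSource (F : ℝ × ℝ → ℝ × ℝ) (p : ℝ × ℝ) : Prop :=
  IsEquilibrium F p ∧ ∀ μ : ℂ, aeval μ (linCharpoly F p) = 0 → 0 < μ.re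

/-- Unstable node: both eigenvalues of the linearization are real and positive. -/
def IsUnstableNode (F : ℝ × ℝ → ℝ × ℝ) (p : ℝ × ℝ) : Prop :=
  IsEquilibrium F p ∧ ∃ a b : ℝ, 0 < a ∧ 0 < b ∧ linCharpoly F p = (X - C a) * (X - C b)

/-- `γ` parametrizes a heteroclinic orbit of `F` from the equilibrium `p` (as `t → -∞`) to the
different equilibrium `q` (as `t → +∞`). -/
structure IsHeteroclinic (F : ℝ × ℝ → ℝ × ℝ) (p q : ℝ × ℝ) (γ : ℝ → ℝ × ℝ) : Prop where
  ne : p ≠ q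
  left : IsEquilibrium F p
  right : IsEquilibrium F q
  flow : ∀ t : ℝ, HasDerivAt γ (F (γ t)) t
  atBot : Tendsto γ atBot (𝓝 p)
  atTop : Tendsto γ atTop (𝓝 q)

end

/-! The origin has eigenvalues `-2` and `N - 2`, so its stable branch can be written explicitly as a
series in `exp (-2 t)`; its coefficients decay geometrically, so it solves the equation for `t > 0`.
The leading term makes `z` positive and decreasing near `+∞` and gives the decay rate.

To continue this branch to all times, use the energy `E = z'^2 / 2 - V(z)`, for which `E' = (N - 4)
z'^2 ≥ 0`. Since `E → 0` at `+∞`, it is negative along the branch and stays so backwards in time. In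
`z > 0` the set `E < 0` is bounded, so no blow-up occurs; truncating the field outside a box makes
this rigorous (`exists_backward_extension`). At `-∞` the monotone bounded energy converges, and
Barbalat's lemma, applied twice, forces convergence to `γ₁` (`tendsto_atBot_of_energy_neg`).

The translates of this orbit are continuum many solutions, and there are only continuum many
continuous functions. The linearization claims reduce to quadratic polynomials. -/

noncomputable section

/-! ### The stable manifold of the origin as a convergent Dirichlet-type series -/

/-- The coefficients `b n` of the solution `∑ b n * exp (-2 (n + 1) t)` decaying at `+∞`. -/
def stableCoeff (N : ℕ) : ℕ → ℝ
  | 0 => 1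
  | m + 1 => -alphaTwo N / (2 * ((m : ℝ) + 1) * (2 * ((m : ℝ) + 1) + N)) *
      ∑ i : Fin (m + 1), stableCoeff N i * stableCoeff N (m - i)
  decreasing_by all_goals omega

lemma stableCoeff_zero (N : ℕ) : stableCoeff N 0 = 1 := by
  rw [stableCoeff]

/-- The denominator is `(r + 2) * (r - (N - 2))`, the characteristic polynomial of the origin, at `r
= -2 (m + 2)`. It never vanishes, so there is no resonance. The antidiagonal sum matches the Cauchy
product of the series with itself. -/
lemma stableCoeff_succ (N m : ℕ) : stableCoeff N (m + 1) =
    -alphaTwo N / (2 * ((m : ℝ) + 1) * (2 * ((m : ℝ) + 1) + N)) *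
      ∑ p ∈ Finset.HasAntidiagonal.antidiagonal m, stableCoeff N p.1 * stableCoeff N p.2 := by
  rw [stableCoeff, Finset.Nat.sum_antidiagonal_eq_sum_range_succ
    (fun i j => stableCoeff N i * stableCoeff N j), Finset.sum_range]

lemma alphaTwo_pos {N : ℕ} (hN : 4 < N) : 0 < alphaTwo N := by
  have : (4 : ℝ) < N := by exact_mod_cast hN
  unfold alphaTwo; linarith

/-- The convolution has `m + 1` terms, which cancel the factor `m + 1` of the denominator; what
remains of the prefactor is at most `1 / 4`. -/
lemma abs_stableCoeff_le {N : ℕ} (hN : 4 < N) (n : ℕ) : |stableCoeff N n| ≤ (1 / 4) ^ n := by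
  have hN' : (4 : ℝ) < N := by exact_mod_cast hN
  induction n using Nat.strong_induction_on with
  | _ n ih =>
    cases n with
    | zero => simp [stableCoeff_zero]
    | succ m =>
      have hsum : |∑ p ∈ Finset.HasAntidiagonal.antidiagonal m, stableCoeff N p.1 * stableCoeff N p.2| ≤
          ((m : ℝ) + 1) * (1 / 4) ^ m := by
        calc _ ≤ ∑ p ∈ Finset.HasAntidiagonal.antidiagonal m, |stableCoeff N p.1 * stableCoeff N p.2| :=
              Finset.abs_sum_le_sum_abs _ _
          _ ≤ ∑ p ∈ Finset.HasAntidiagonal.antidiagonal m, (1 / 4 : ℝ) ^ m := by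
              refine Finset.sum_le_sum fun p hp => ?_
              have hp' := Finset.HasAntidiagonal.mem_antidiagonal.mp hp
              rw [abs_mul, ← hp', pow_add]
              exact mul_le_mul (ih _ (by omega)) (ih _ (by omega)) (abs_nonneg _) (by positivity)
          _ = _ := by simp
      have hα := alphaTwo_pos hN
      have hm : (0 : ℝ) ≤ m := Nat.cast_nonneg m
      rw [stableCoeff_succ, abs_mul, abs_div, abs_neg, abs_of_pos hα,
        abs_of_pos (by positivity : 0 < 2 * ((m : ℝ) + 1) * (2 * ((m : ℝ) + 1) + N))]
      calc _ ≤ alphaTwo N / (2 * ((m : ℝ) + 1) * (2 * ((m : ℝ) + 1) + N)) *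
            (((m : ℝ) + 1) * (1 / 4) ^ m) := by gcongr
        _ = alphaTwo N / (2 * (2 * ((m : ℝ) + 1) + N)) * (1 / 4) ^ m := by
            field_simp
        _ ≤ 1 / 4 * (1 / 4) ^ m := by
            refine mul_le_mul_of_nonneg_right ?_ (by positivity)
            rw [div_le_div_iff₀ (by positivity) (by norm_num)]
            unfold alphaTwo
            linarith
        _ = _ := by ring

/-- The `n`-th term of the `j`-th derivative of the decaying solution. -/
def stableTerm (N j n : ℕ) (t : ℝ) : ℝ :=
  (-2 * ((n : ℝ) + 1)) ^ j * stableCoeff N n * Real.exp (-2 * ((n : ℝ) + 1) * t)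

/-- The `j`-th derivative of the decaying solution. -/
def stableSeries (N j : ℕ) (t : ℝ) : ℝ := ∑' n, stableTerm N j n t

/-- This majorant does not depend on `t`, so it serves both for termwise differentiation on `t > 0`
and for dominated convergence at `+∞`. -/
lemma summable_stableBound (j : ℕ) :
    Summable fun n : ℕ => (2 * ((n : ℝ) + 1)) ^ j * (1 / 4 : ℝ) ^ n := by
  have h := summable_pow_mul_geometric_of_norm_lt_one (R := ℝ) j (r := 1 / 4) (by norm_num)
  have h2 := ((summable_nat_add_iff 1).mpr h).mul_left (2 ^ j * 4)
  refine h2.congr fun n => ?_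
  push_cast
  rw [mul_pow, pow_succ]
  ring

lemma hasDerivAt_stableTerm (N j n : ℕ) (t : ℝ) :
    HasDerivAt (stableTerm N j n) (stableTerm N (j + 1) n t) t := by
  have h := (((hasDerivAt_id t).const_mul (-2 * ((n : ℝ) + 1))).exp).const_mul
    ((-2 * ((n : ℝ) + 1)) ^ j * stableCoeff N n)
  refine h.congr_deriv ?_
  simp only [stableTerm, id]
  ring

lemma abs_stableTerm_le {N : ℕ} (hN : 4 < N) (j n : ℕ) {t : ℝ} (ht : 0 < t) :
    ‖stableTerm N j n t‖ ≤ (2 * ((n : ℝ) + 1)) ^ j * (1 / 4 : ℝ) ^ n := by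
  have hexp : Real.exp (-2 * ((n : ℝ) + 1) * t) ≤ 1 := by
    rw [Real.exp_le_one_iff]
    have : 0 ≤ ((n : ℝ) + 1) * t := by positivity
    linarith
  rw [stableTerm, Real.norm_eq_abs, abs_mul, abs_mul, abs_pow, Real.abs_exp, neg_mul, abs_neg,
    abs_of_pos (by positivity : 0 < 2 * ((n : ℝ) + 1))]
  calc _ ≤ (2 * ((n : ℝ) + 1)) ^ j * (1 / 4 : ℝ) ^ n * 1 := by
        gcongr
        · exact abs_stableCoeff_le hN n
        · simpa using hexp
    _ = _ := mul_one _

lemma summable_stableTerm {N : ℕ} (hN : 4 < N) (j : ℕ) {t : ℝ} (ht : 0 < t) :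
    Summable fun n => stableTerm N j n t :=
  .of_norm_bounded (summable_stableBound j) fun n => abs_stableTerm_le hN j n ht

lemma hasDerivAt_stableSeries {N : ℕ} (hN : 4 < N) (j : ℕ) {t : ℝ} (ht : 0 < t) :
    HasDerivAt (stableSeries N j) (stableSeries N (j + 1) t) t :=
  hasDerivAt_tsum_of_isPreconnected (summable_stableBound (j + 1)) isOpen_Ioi
    isPreconnected_Ioi (fun n y _ => hasDerivAt_stableTerm N j n y)
    (fun n _ hy => abs_stableTerm_le hN (j + 1) n hy) (Set.mem_Ioi.mpr ht)
    (summable_stableTerm hN j ht) (Set.mem_Ioi.mpr ht)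

lemma stableSeries_eqn {N : ℕ} (hN : 4 < N) {t : ℝ} (ht : 0 < t) :
    stableSeries N 2 t = ((N : ℝ) - 4) * stableSeries N 1 t + (2 * (N : ℝ) - 4) * stableSeries N 0 t
      - alphaTwo N * stableSeries N 0 t ^ 2 := by
  have h0 := summable_stableTerm hN 0 ht
  have h1 := summable_stableTerm hN 1 ht
  have h2 := summable_stableTerm hN 2 ht
  have hsq : stableSeries N 0 t ^ 2 = ∑' m, ∑ p ∈ Finset.HasAntidiagonal.antidiagonal m,
      stableTerm N 0 p.1 t * stableTerm N 0 p.2 t := by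
    rw [sq]
    exact tsum_mul_tsum_eq_tsum_sum_antidiagonal_of_summable_norm h0.norm h0.norm
  have hlin : stableSeries N 2 t - ((N : ℝ) - 4) * stableSeries N 1 t
      - (2 * (N : ℝ) - 4) * stableSeries N 0 t = ∑' n, (stableTerm N 2 n t
        - ((N : ℝ) - 4) * stableTerm N 1 n t - (2 * (N : ℝ) - 4) * stableTerm N 0 n t) := by
    rw [(h2.sub (h1.mul_left _)).tsum_sub (h0.mul_left _), h2.tsum_sub (h1.mul_left _),
      tsum_mul_left, tsum_mul_left]
    rfl
  have hshift : ∑' n, (stableTerm N 2 n t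
        - ((N : ℝ) - 4) * stableTerm N 1 n t - (2 * (N : ℝ) - 4) * stableTerm N 0 n t) =
      ∑' m, -alphaTwo N * ∑ p ∈ Finset.HasAntidiagonal.antidiagonal m,
        stableTerm N 0 p.1 t * stableTerm N 0 p.2 t := by
    rw [((h2.sub (h1.mul_left _)).sub (h0.mul_left _)).tsum_eq_zero_add]
    -- The leading exponent `-2` is an eigenvalue, so the linear part kills this term. After the
    -- shift by one, the remaining terms match the square of the series.
    have hz : stableTerm N 2 0 t - ((N : ℝ) - 4) * stableTerm N 1 0 t
        - (2 * (N : ℝ) - 4) * stableTerm N 0 0 t = 0 := by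
      simp only [stableTerm, Nat.cast_zero]
      ring
    rw [hz, zero_add]
    refine tsum_congr fun m => ?_
    have hterm : ∀ p ∈ Finset.HasAntidiagonal.antidiagonal m, stableTerm N 0 p.1 t * stableTerm N 0 p.2 t =
        Real.exp (-2 * ((m : ℝ) + 2) * t) * (stableCoeff N p.1 * stableCoeff N p.2) := by
      intro p hp
      have hp' : (p.1 : ℝ) + p.2 = m := by exact_mod_cast Finset.HasAntidiagonal.mem_antidiagonal.mp hp
      have : Real.exp (-2 * ((m : ℝ) + 2) * t) =
          Real.exp (-2 * ((p.1 : ℝ) + 1) * t) * Real.exp (-2 * ((p.2 : ℝ) + 1) * t) := by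
        rw [← Real.exp_add, ← hp']
        congr 1
        ring
      rw [this]
      simp only [stableTerm]
      ring
    rw [Finset.sum_congr rfl hterm, ← Finset.mul_sum]
    have hexp : Real.exp (-2 * (((m + 1 : ℕ) : ℝ) + 1) * t) =
        Real.exp (-2 * ((m : ℝ) + 2) * t) := by
      congr 1; push_cast; ring
    simp only [stableTerm, hexp, stableCoeff_succ]
    push_cast
    have hm : (0 : ℝ) ≤ m := Nat.cast_nonneg m
    have hN' : (4 : ℝ) < N := by exact_mod_cast hN
    have : 2 * ((m : ℝ) + 1) + N ≠ 0 := by positivity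
    field_simp
    ring
  have := hlin.trans hshift
  rw [tsum_mul_left, ← hsq] at this
  linarith

/-- Only the term `n = 0` survives the factor `exp (2 t)`. The cases `j = 0` and `j = 1` give the
decay rate and the signs of `z` and `z'` near `+∞`. -/
lemma tendsto_exp_mul_stableSeries {N : ℕ} (hN : 4 < N) (j : ℕ) :
    Tendsto (fun t => Real.exp (2 * t) * stableSeries N j t) atTop (𝓝 ((-2) ^ j)) := by
  have key : Tendsto (fun t => ∑' n, Real.exp (2 * t) * stableTerm N j n t) atTop
      (𝓝 (∑' n, if n = 0 then (-2 : ℝ) ^ j else 0)) := by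
    refine tendsto_tsum_of_dominated_convergence (summable_stableBound j) (fun n => ?_) ?_
    · rcases eq_or_ne n 0 with rfl | hn
      · refine tendsto_const_nhds.congr fun t => ?_
        simp only [stableTerm, stableCoeff_zero, if_true, Nat.cast_zero]
        rw [mul_left_comm, ← Real.exp_add]
        ring_nf
        simp
      · rw [if_neg hn]
        have hn' : (0 : ℝ) < n := by exact_mod_cast Nat.pos_of_ne_zero hn
        have hlim : Tendsto (fun t : ℝ => Real.exp (-(2 * (n : ℝ) * t))) atTop (𝓝 0) :=
          Real.tendsto_exp_neg_atTop_nhds_zero.comp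
            (tendsto_id.const_mul_atTop (by positivity : 0 < 2 * (n : ℝ)))
        have := hlim.const_mul ((-2 * ((n : ℝ) + 1)) ^ j * stableCoeff N n)
        rw [mul_zero] at this
        refine this.congr fun t => ?_
        rw [stableTerm, mul_left_comm, ← Real.exp_add]
        ring_nf
    · filter_upwards [eventually_gt_atTop 0] with t ht n
      have hexp : Real.exp (2 * t) * Real.exp (-2 * ((n : ℝ) + 1) * t) ≤ 1 := by
        rw [← Real.exp_add, Real.exp_le_one_iff]
        have : 0 ≤ (n : ℝ) * t := by positivity
        linarith
      rw [stableTerm, mul_left_comm, Real.norm_eq_abs, abs_mul, abs_mul, abs_pow,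
        abs_of_pos (by positivity :
          0 < Real.exp (2 * t) * Real.exp (-2 * ((n : ℝ) + 1) * t)),
        neg_mul, abs_neg, abs_of_pos (by positivity : 0 < 2 * ((n : ℝ) + 1))]
      calc _ ≤ (2 * ((n : ℝ) + 1)) ^ j * (1 / 4 : ℝ) ^ n * 1 := by
            gcongr
            · exact abs_stableCoeff_le hN n
            · simpa only [neg_mul] using hexp
        _ = _ := mul_one _
  rw [tsum_ite_eq] at key
  refine key.congr fun t => ?_
  rw [tsum_mul_left, stableSeries]

/-! ### Global flows of bounded Lipschitz fields and a Barbalat lemma -/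

/-- A bounded, globally Lipschitz vector field has a global solution through every point. -/
lemma exists_global_solution {E : Type*} [NormedAddCommGroup E] [NormedSpace ℝ E] [CompleteSpace E]
    {F : E → E} {K L : NNReal} (hF : LipschitzWith K F) (hb : ∀ x, ‖F x‖ ≤ L) (t₀ : ℝ) (x₀ : E) :
    ∃ γ : ℝ → E, γ t₀ = x₀ ∧ ∀ t, HasDerivAt γ (F (γ t)) t := by
  have hloc : ∀ n : ℕ, ∃ α : ℝ → E, α t₀ = x₀ ∧
      ∀ t ∈ Set.Ioo (t₀ - (n + 1)) (t₀ + (n + 1)), HasDerivAt α (F (α t)) t := by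
    intro n
    have hn : (0 : ℝ) ≤ (n : ℝ) + 1 := by positivity
    have hmem : t₀ ∈ Set.Icc (t₀ - ((n : ℝ) + 1)) (t₀ + (n + 1)) := ⟨by linarith, by linarith⟩
    -- At speed at most `L` a solution cannot leave the ball of radius `L * (n + 1)` within time `n
    -- + 1`, so the existence time is unrestricted. The local solutions are then glued by
    -- uniqueness.
    have hP : IsPicardLindelof (fun _ => F) (⟨t₀, hmem⟩ : Set.Icc _ _) x₀ (L * (n + 1)) 0 L K := by
      refine .of_time_independent (fun x _ => hb x) hF.lipschitzOnWith ?_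
      simp
    obtain ⟨α, h0, hα⟩ := hP.exists_eq_forall_mem_Icc_hasDerivWithinAt₀
    exact ⟨α, h0, fun t ht => (hα t (Set.Ioo_subset_Icc_self ht)).hasDerivAt
      (Icc_mem_nhds ht.1 ht.2)⟩
  choose α h0 hα using hloc
  have huniq : ∀ m n : ℕ, m ≤ n → ∀ t ∈ Set.Ioo (t₀ - ((m : ℝ) + 1)) (t₀ + (m + 1)),
      α m t = α n t := by
    intro m n hmn
    have hmn' : (m : ℝ) ≤ n := by exact_mod_cast hmn
    have hm : (0 : ℝ) ≤ m := Nat.cast_nonneg m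
    exact ODE_solution_unique_of_mem_Ioo (v := fun _ => F) (s := fun _ => Set.univ) (t₀ := t₀)
      (fun t _ => hF.lipschitzOnWith) ⟨by linarith, by linarith⟩
      (fun t ht => ⟨hα m t ht, trivial⟩)
      (fun t ht => ⟨hα n t ⟨by linarith [ht.1], by linarith [ht.2]⟩, trivial⟩)
      ((h0 m).trans (h0 n).symm)
  have hmem : ∀ t : ℝ, ∀ n : ℕ, |t - t₀| < n + 1 →
      t ∈ Set.Ioo (t₀ - ((n : ℝ) + 1)) (t₀ + (n + 1)) := by
    intro t n h
    rw [abs_lt] at h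
    exact ⟨by linarith, by linarith⟩
  have hlt : ∀ t : ℝ, |t - t₀| < (⌈|t - t₀|⌉₊ : ℝ) + 1 := fun t =>
    (Nat.le_ceil _).trans_lt (lt_add_one _)
  set γ : ℝ → E := fun t => α ⌈|t - t₀|⌉₊ t with hγ
  have hγα : ∀ n : ℕ, ∀ t, |t - t₀| < n + 1 → γ t = α n t := by
    intro n t ht
    rcases le_total ⌈|t - t₀|⌉₊ n with h | h
    · exact huniq _ _ h t (hmem t _ (hlt t))
    · exact (huniq _ _ h t (hmem t _ ht)).symm
  refine ⟨γ, by simp [hγ, h0], fun t => ?_⟩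
  set n := ⌈|t - t₀|⌉₊ with hn
  have hev : ∀ᶠ u in 𝓝 t, γ u = α n u := by
    have : ∀ᶠ u in 𝓝 t, |u - t₀| < n + 1 :=
      (by fun_prop : Continuous fun u : ℝ => |u - t₀|).continuousAt.eventually_lt_const (hlt t)
    exact this.mono fun u hu => hγα n u hu
  rw [hev.self_of_nhds]
  exact (hα n t (hmem t n (hlt t))).congr_of_eventuallyEq hev

/-- If `f` converges at `-∞` and `f''` is bounded, then `f'` tends to zero at `-∞`. -/
lemma tendsto_deriv_atBot_of_tendsto {f g h : ℝ → ℝ} {l C : ℝ}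
    (hf : ∀ t, HasDerivAt f (g t) t) (hg : ∀ t, HasDerivAt g (h t) t) (hC : ∀ t, |h t| ≤ C)
    (hl : Tendsto f atBot (𝓝 l)) : Tendsto g atBot (𝓝 0) := by
  have hC0 : 0 ≤ C := (abs_nonneg _).trans (hC 0)
  have hglip : ∀ s t, |g s - g t| ≤ C * |s - t| := fun s t => by
    have := Convex.norm_image_sub_le_of_norm_hasDerivWithin_le (s := Set.univ) (f := g) (f' := h)
      (C := C) (x := t) (y := s) (fun x _ => (hg x).hasDerivWithinAt) (fun x _ => hC x)
      convex_univ trivial trivial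
    simpa using this
  -- A first-order Taylor estimate on `[t - δ, t]`: the increment of `f` is small far to the left,
  -- and `δ` is chosen afterwards so that `C * δ ≤ ε / 2`.
  have hmv : ∀ δ > 0, ∀ t, δ * |g t| ≤ |f t - f (t - δ)| + C * δ * δ := by
    intro δ hδ t
    have hd : ∀ x ∈ Set.Icc (t - δ) t,
        HasDerivWithinAt (fun u => f u - g t * u) (g x - g t) (Set.Icc (t - δ) t) x := by
      intro x _
      have := (hf x).fun_sub ((hasDerivAt_id' x).const_mul (g t))
      rw [mul_one] at this
      exact this.hasDerivWithinAt
    have hbd : ∀ x ∈ Set.Icc (t - δ) t, ‖g x - g t‖ ≤ C * δ := by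
      intro x hx
      refine (hglip x t).trans ?_
      gcongr
      rw [abs_le]
      constructor <;> linarith [hx.1, hx.2]
    have := Convex.norm_image_sub_le_of_norm_hasDerivWithin_le hd hbd (convex_Icc _ _)
      (x := t - δ) (y := t) ⟨le_rfl, by linarith⟩ ⟨by linarith, le_rfl⟩
    simp only [Real.norm_eq_abs] at this
    rw [show t - (t - δ) = δ by ring, abs_of_pos hδ,
      show f t - g t * t - (f (t - δ) - g t * (t - δ)) = f t - f (t - δ) - δ * g t by ring] at this
    have h1 : δ * |g t| = |δ * g t| := by rw [abs_mul, abs_of_pos hδ]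
    rw [h1]
    have h2 := abs_sub_abs_le_abs_sub (δ * g t) (f t - f (t - δ))
    rw [abs_sub_comm (δ * g t)] at h2
    linarith
  rw [Metric.tendsto_nhds]
  intro ε hε
  set δ := ε / (2 * (C + 1)) with hδ
  have hδ0 : 0 < δ := by positivity
  have hCδ : C * δ ≤ ε / 2 := by
    rw [hδ, ← mul_div_assoc, div_le_div_iff₀ (by positivity) (by norm_num)]
    nlinarith
  have hdiff : Tendsto (fun t => |f t - f (t - δ)|) atBot (𝓝 0) := by
    have h1 : Tendsto (fun t => f (t - δ)) atBot (𝓝 l) :=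
      hl.comp (tendsto_atBot_add_const_right _ _ tendsto_id)
    simpa using (hl.sub h1).abs
  filter_upwards [hdiff.eventually_lt_const (by positivity : 0 < δ * (ε / 2))] with t ht
  have h1 := hmv δ hδ0 t
  have h2 : C * δ * δ ≤ ε / 2 * δ := by gcongr
  rw [Real.dist_eq, sub_zero]
  by_contra! hcon
  have : δ * ε ≤ δ * |g t| := by gcongr
  nlinarith

/-! ### The truncated system and its energy -/

/-- The projection of the real line onto `[a, b]`. -/
def clamp (a b x : ℝ) : ℝ := max a (min b x)

lemma clamp_mem {a b : ℝ} (hab : a ≤ b) (x : ℝ) : clamp a b x ∈ Set.Icc a b :=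
  ⟨le_max_left _ _, max_le hab (min_le_left _ _)⟩

lemma clamp_of_mem {a b x : ℝ} (hx : x ∈ Set.Icc a b) : clamp a b x = x := by
  rw [clamp, min_eq_right hx.2, max_eq_right hx.1]

lemma clamp_of_le {a b x : ℝ} (hx : x ≤ a) : clamp a b x = a :=
  max_eq_left ((min_le_right _ _).trans hx)

lemma clamp_of_ge {a b x : ℝ} (hab : a ≤ b) (hx : b ≤ x) : clamp a b x = b := by
  rw [clamp, min_eq_left hx, max_eq_right hab]

lemma lipschitzWith_clamp (a b : ℝ) : LipschitzWith 1 (clamp a b) :=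
  (LipschitzWith.id.const_min b).const_max a

/-- The reaction term `c z - α z²` of the second order equation. -/
def reaction (c α z : ℝ) : ℝ := c * z - α * z ^ 2

/-- The potential `c z² / 2 - α z³ / 3`, a primitive of the reaction term. -/
def potential (c α z : ℝ) : ℝ := c * z ^ 2 / 2 - α * z ^ 3 / 3

/-- The positive zero of the potential. -/
def potentialZero (c α : ℝ) : ℝ := 3 * c / (2 * α)

/-- A bound for the velocities of negative energy. -/
def speedBound (c α : ℝ) : ℝ := (c + 1) * potentialZero c α

/-- The reaction term made constant outside `[0, potentialZero c α]`. -/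
def truncReaction (c α z : ℝ) : ℝ := reaction c α (clamp 0 (potentialZero c α) z)

/-- The velocity truncated at `speedBound c α`. -/
def truncSpeed (c α y : ℝ) : ℝ := clamp (-speedBound c α) (speedBound c α) y

/-- The truncated vector field. -/
def truncField (k c α : ℝ) (p : ℝ × ℝ) : ℝ × ℝ :=
  (truncSpeed c α p.2, k * truncSpeed c α p.2 + truncReaction c α p.1)

/-- The kinetic part of the energy of the truncated system. -/
def truncKinetic (c α y : ℝ) : ℝ := ∫ s in (0 : ℝ)..y, truncSpeed c α s

/-- The potential part of the energy of the truncated system. -/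
def truncPotential (c α z : ℝ) : ℝ := ∫ s in (0 : ℝ)..z, truncReaction c α s

section trunc

variable {k c α : ℝ}

lemma hasDerivAt_potential (c α z : ℝ) : HasDerivAt (potential c α) (reaction c α z) z := by
  have := (((hasDerivAt_pow 2 z).const_mul c).div_const 2).sub
    (((hasDerivAt_pow 3 z).const_mul α).div_const 3)
  refine this.congr_deriv ?_
  simp only [reaction]
  push_cast
  ring

lemma potential_eq (hα : 0 < α) (z : ℝ) :
    potential c α z = α / 3 * z ^ 2 * (potentialZero c α - z) := by
  unfold potential potentialZero
  field_simp

lemma potentialZero_pos (hc : 0 < c) (hα : 0 < α) : 0 < potentialZero c α := by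
  unfold potentialZero; positivity

lemma speedBound_pos (hc : 0 < c) (hα : 0 < α) : 0 < speedBound c α :=
  mul_pos (by linarith) (potentialZero_pos hc hα)

lemma potential_lt {z : ℝ} (hc : 0 < c) (hα : 0 < α) (h0 : 0 < z) (hz : z < potentialZero c α) :
    potential c α z < speedBound c α ^ 2 / 2 := by
  have h1 : c * z ^ 2 ≤ c * potentialZero c α ^ 2 := by gcongr
  have h2 : 0 ≤ α * z ^ 3 := by positivity
  have h3 := potentialZero_pos hc hα
  have h4 : c * potentialZero c α ^ 2 < speedBound c α ^ 2 := by
    unfold speedBound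
    rw [mul_pow]
    gcongr
    nlinarith
  unfold potential
  linarith

lemma continuous_truncReaction (c α : ℝ) : Continuous (truncReaction c α) := by
  unfold truncReaction reaction clamp
  fun_prop

lemma continuous_truncSpeed (c α : ℝ) : Continuous (truncSpeed c α) := by
  unfold truncSpeed clamp
  fun_prop

lemma hasDerivAt_truncKinetic (c α y : ℝ) :
    HasDerivAt (truncKinetic c α) (truncSpeed c α y) y :=
  (continuous_truncSpeed c α).integral_hasStrictDerivAt 0 y |>.hasDerivAt

lemma hasDerivAt_truncPotential (c α z : ℝ) :
    HasDerivAt (truncPotential c α) (truncReaction c α z) z :=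
  (continuous_truncReaction c α).integral_hasStrictDerivAt 0 z |>.hasDerivAt

/-- The original potential is positive for `z < 0`, so negative energy alone would not confine `z`.
The truncation flattens this side and thereby forces `z > 0`. -/
lemma truncPotential_of_nonpos {z : ℝ} (hz : z ≤ 0) : truncPotential c α z = 0 := by
  have : Set.EqOn (truncReaction c α) (fun _ => 0) (Set.uIcc 0 z) := by
    intro s hs
    rw [Set.uIcc_of_ge hz] at hs
    simp [truncReaction, clamp_of_le hs.2, reaction]
  rw [truncPotential, intervalIntegral.integral_congr this]
  simp

lemma truncPotential_of_mem {z : ℝ} (hz : z ∈ Set.Icc 0 (potentialZero c α)) :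
    truncPotential c α z = potential c α z := by
  have : Set.EqOn (truncReaction c α) (reaction c α) (Set.uIcc 0 z) := by
    intro s hs
    rw [Set.uIcc_of_le hz.1] at hs
    rw [truncReaction, clamp_of_mem ⟨hs.1, hs.2.trans hz.2⟩]
  rw [truncPotential, intervalIntegral.integral_congr this,
    intervalIntegral.integral_eq_sub_of_hasDerivAt (fun x _ => hasDerivAt_potential c α x)]
  · simp [potential]
  · apply Continuous.intervalIntegrable
    unfold reaction
    fun_prop

/-- The potential vanishes at `potentialZero c α`, and beyond it the frozen reaction is the negative
constant `-(c * potentialZero c α / 2)`. -/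
lemma truncPotential_of_ge (hc : 0 < c) (hα : 0 < α) {z : ℝ} (hz : potentialZero c α ≤ z) :
    truncPotential c α z ≤ 0 := by
  have hR := potentialZero_pos hc hα
  have hint := fun a b => (continuous_truncReaction c α).intervalIntegrable
    (μ := MeasureTheory.volume) a b
  have h1 : truncPotential c α (potentialZero c α) = 0 := by
    rw [truncPotential_of_mem ⟨hR.le, le_rfl⟩, potential_eq hα]
    ring
  have h2 : truncPotential c α z = truncPotential c α (potentialZero c α) +
      ∫ s in (potentialZero c α)..z, truncReaction c α s :=
    (intervalIntegral.integral_add_adjacent_intervals (hint _ _) (hint _ _)).symm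
  rw [h2, h1, zero_add]
  rw [← neg_nonneg, ← intervalIntegral.integral_neg]
  refine intervalIntegral.integral_nonneg hz fun s hs => ?_
  rw [truncReaction, clamp_of_ge hR.le hs.1]
  have : reaction c α (potentialZero c α) = -(c * potentialZero c α / 2) := by
    unfold reaction potentialZero
    field_simp
    ring
  rw [this]
  have : 0 < c * potentialZero c α := by positivity
  linarith

lemma truncKinetic_of_abs_le {y : ℝ} (hy : |y| ≤ speedBound c α) :
    truncKinetic c α y = y ^ 2 / 2 := by
  have : Set.EqOn (truncSpeed c α) (fun s => s) (Set.uIcc 0 y) := by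
    intro s hs
    have h0 := (abs_nonneg y).trans hy
    exact clamp_of_mem (Set.uIcc_subset_Icc ⟨by linarith, h0⟩ (abs_le.mp hy) hs)
  rw [truncKinetic, intervalIntegral.integral_congr this]
  simp

lemma le_truncKinetic_of_le_abs (hc : 0 < c) (hα : 0 < α) {y : ℝ} (hy : speedBound c α ≤ |y|) :
    speedBound c α ^ 2 / 2 ≤ truncKinetic c α y := by
  have hY := speedBound_pos hc hα
  have hint := fun a b => (continuous_truncSpeed c α).intervalIntegrable
    (μ := MeasureTheory.volume) a b
  have hsplit : ∀ x, truncKinetic c α y = truncKinetic c α x + ∫ s in x..y, truncSpeed c α s :=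
    fun x => (intervalIntegral.integral_add_adjacent_intervals (hint _ _) (hint _ _)).symm
  rcases le_abs.mp hy with h | h
  · rw [hsplit (speedBound c α), truncKinetic_of_abs_le (abs_of_pos hY).le]
    have : 0 ≤ ∫ s in (speedBound c α)..y, truncSpeed c α s := by
      refine intervalIntegral.integral_nonneg h fun s hs => ?_
      rw [truncSpeed, clamp_of_ge (by linarith) hs.1]
      exact hY.le
    linarith
  · rw [hsplit (-speedBound c α), truncKinetic_of_abs_le (by rw [abs_neg, abs_of_pos hY]),
      intervalIntegral.integral_symm]
    have : ∫ s in y..(-speedBound c α), truncSpeed c α s ≤ 0 := by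
      rw [← neg_nonneg, ← intervalIntegral.integral_neg]
      refine intervalIntegral.integral_nonneg (by linarith) fun s hs => ?_
      rw [truncSpeed, clamp_of_le hs.2]
      linarith
    rw [neg_sq]
    linarith

lemma truncKinetic_nonneg (hc : 0 < c) (hα : 0 < α) (y : ℝ) : 0 ≤ truncKinetic c α y := by
  rcases le_total |y| (speedBound c α) with h | h
  · rw [truncKinetic_of_abs_le h]; positivity
  · exact le_trans (by positivity) (le_truncKinetic_of_le_abs hc hα h)

/-- States of negative energy lie in the region where nothing is truncated. -/
lemma bounds_of_truncEnergy_neg (hc : 0 < c) (hα : 0 < α) {z y : ℝ}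
    (h : truncKinetic c α y - truncPotential c α z < 0) :
    0 < z ∧ z < potentialZero c α ∧ |y| < speedBound c α := by
  have hH := truncKinetic_nonneg hc hα y
  have hz0 : 0 < z := by
    by_contra! hz
    rw [truncPotential_of_nonpos hz] at h
    linarith
  have hzR : z < potentialZero c α := by
    by_contra! hz
    linarith [truncPotential_of_ge hc hα hz]
  refine ⟨hz0, hzR, ?_⟩
  by_contra! hy
  have := le_truncKinetic_of_le_abs hc hα hy
  rw [truncPotential_of_mem ⟨hz0.le, hzR.le⟩] at h
  linarith [potential_lt hc hα hz0 hzR]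

lemma bounds_of_energy_neg (hc : 0 < c) (hα : 0 < α) {z y : ℝ} (hz : 0 < z)
    (h : y ^ 2 / 2 - potential c α z < 0) : z < potentialZero c α ∧ |y| < speedBound c α := by
  have hzR : z < potentialZero c α := by
    by_contra! hzR
    rw [potential_eq hα] at h
    have : 0 ≤ α / 3 * z ^ 2 * (z - potentialZero c α) := by
      have := sub_nonneg.mpr hzR
      positivity
    nlinarith [sq_nonneg y]
  refine ⟨hzR, abs_lt_of_sq_lt_sq ?_ (speedBound_pos hc hα).le⟩
  linarith [potential_lt hc hα hz hzR]

lemma truncField_eq {p : ℝ × ℝ} (h0 : 0 < p.1) (h1 : p.1 < potentialZero c α)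
    (h2 : |p.2| < speedBound c α) : truncField k c α p = (p.2, k * p.2 + reaction c α p.1) := by
  have := abs_lt.mp h2
  rw [truncField, truncReaction, truncSpeed, clamp_of_mem ⟨h0.le, h1.le⟩,
    clamp_of_mem ⟨this.1.le, this.2.le⟩]

lemma exists_lipschitzWith_truncField (hc : 0 < c) (hα : 0 < α) :
    ∃ K, LipschitzWith K (truncField k c α) := by
  have hR := potentialZero_pos hc hα
  have hr : LipschitzWith (c + 2 * α * potentialZero c α).toNNReal (truncReaction c α) := by
    refine LipschitzWith.of_dist_le_mul fun x y => ?_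
    rw [Real.coe_toNNReal _ (by positivity)]
    have hxy := (lipschitzWith_clamp 0 (potentialZero c α)).dist_le_mul x y
    have hx := clamp_mem hR.le x
    have hy := clamp_mem hR.le y
    simp only [truncReaction, Real.dist_eq, NNReal.coe_one, one_mul] at *
    set a := clamp 0 (potentialZero c α) x
    set b := clamp 0 (potentialZero c α) y
    rw [show reaction c α a - reaction c α b = (c - α * (a + b)) * (a - b) by
      unfold reaction; ring, abs_mul]
    refine mul_le_mul ?_ hxy (abs_nonneg _) (by positivity)
    rw [abs_le]
    have h1 : α * (a + b) ≤ 2 * α * potentialZero c α := by nlinarith [hx.2, hy.2]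
    have h2 : 0 ≤ α * (a + b) := mul_nonneg hα.le (add_nonneg hx.1 hy.1)
    have h3 : 0 ≤ α * potentialZero c α := by positivity
    constructor <;> linarith
  have hs : LipschitzWith 1 (fun p : ℝ × ℝ => truncSpeed c α p.2) := by
    have := (lipschitzWith_clamp (-speedBound c α) (speedBound c α)).comp
      (LipschitzWith.prod_snd (α := ℝ) (β := ℝ))
    rw [mul_one] at this
    exact this
  have hks : LipschitzWith _ (fun p : ℝ × ℝ => k * truncSpeed c α p.2) :=
    (lipschitzWith_smul k).comp hs
  exact ⟨_, hs.prodMk (hks.add (hr.comp LipschitzWith.prod_fst))⟩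

lemma exists_norm_truncField_le (hc : 0 < c) (hα : 0 < α) :
    ∃ L : NNReal, ∀ p, ‖truncField k c α p‖ ≤ L := by
  have hY := speedBound_pos hc hα
  have hR := potentialZero_pos hc hα
  -- The truncated field is the original one evaluated at the clamped point, which lies in this
  -- compact box.
  set S := Set.Icc (0 : ℝ) (potentialZero c α) ×ˢ Set.Icc (-speedBound c α) (speedBound c α)
  have hS : IsCompact S := isCompact_Icc.prod isCompact_Icc
  obtain ⟨L, hL⟩ := hS.exists_bound_of_continuousOn
    (f := fun p : ℝ × ℝ => (p.2, k * p.2 + reaction c α p.1))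
    (by unfold reaction; fun_prop)
  refine ⟨L.toNNReal, fun p => (hL (clamp 0 (potentialZero c α) p.1, truncSpeed c α p.2)
    ⟨clamp_mem hR.le _, clamp_mem (by linarith) _⟩).trans (Real.le_coe_toNNReal L)⟩

lemma monotone_truncEnergy (hk : 0 < k) {γ : ℝ → ℝ × ℝ}
    (hγ : ∀ t, HasDerivAt γ (truncField k c α (γ t)) t) :
    Monotone fun t => truncKinetic c α (γ t).2 - truncPotential c α (γ t).1 := by
  have hd : ∀ t, HasDerivAt (fun t => truncKinetic c α (γ t).2 - truncPotential c α (γ t).1)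
      (k * truncSpeed c α (γ t).2 ^ 2) t := by
    intro t
    have h1 : HasDerivAt (fun t => (γ t).1) (truncField k c α (γ t)).1 t := (hγ t).fst
    have h2 : HasDerivAt (fun t => (γ t).2) (truncField k c α (γ t)).2 t := (hγ t).snd
    have := ((hasDerivAt_truncKinetic c α (γ t).2).comp t h2).sub
      ((hasDerivAt_truncPotential c α (γ t).1).comp t h1)
    refine this.congr_deriv ?_
    simp only [truncField]
    ring
  exact monotone_of_hasDerivAt_nonneg hd fun t => by positivity

end trunc

/-- `z` and its velocity `y` solve `z'' = k z' + c z - α z²` at time `t`. -/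
def SolvesAt (k c α : ℝ) (z y : ℝ → ℝ) (t : ℝ) : Prop :=
  HasDerivAt z (y t) t ∧ HasDerivAt y (k * y t + reaction c α (z t)) t

/-- The energy along a solution. -/
def energy (c α : ℝ) (z y : ℝ → ℝ) (t : ℝ) : ℝ := y t ^ 2 / 2 - potential c α (z t)

lemma SolvesAt.hasDerivAt_energy {k c α : ℝ} {z y : ℝ → ℝ} {t : ℝ} (h : SolvesAt k c α z y t) :
    HasDerivAt (energy c α z y) (k * y t ^ 2) t := by
  have := ((h.2.pow 2).div_const 2).sub ((hasDerivAt_potential c α (z t)).comp t h.1)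
  refine this.congr_deriv ?_
  push_cast
  ring

/-- A solution that decreases to the origin extends backwards to all times, with
negative energy. -/
lemma exists_backward_extension {k c α T : ℝ} (hk : 0 < k) (hc : 0 < c) (hα : 0 < α)
    {z₀ y₀ : ℝ → ℝ} (hsol : ∀ t ≥ T, SolvesAt k c α z₀ y₀ t)
    (hz : ∀ t ≥ T, 0 < z₀ t) (hy : ∀ t ≥ T, y₀ t < 0)
    (hz0 : Tendsto z₀ atTop (𝓝 0)) (hy0 : Tendsto y₀ atTop (𝓝 0)) :
    ∃ z y : ℝ → ℝ, (∀ t, SolvesAt k c α z y t) ∧ (∀ t, 0 < z t) ∧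
      (∀ t, energy c α z y t < 0) ∧ ∀ t ≥ T, z t = z₀ t ∧ y t = y₀ t := by
  have hE0 : ∀ t ≥ T, energy c α z₀ y₀ t < 0 := by
    have hmono : StrictMonoOn (energy c α z₀ y₀) (Set.Ici T) := by
      refine strictMonoOn_of_hasDerivWithinAt_pos (convex_Ici T)
        (HasDerivAt.continuousOn fun t ht => (hsol t ht).hasDerivAt_energy)
        (f' := fun t => k * y₀ t ^ 2) (fun t ht => ?_) fun t ht => ?_
      · exact (hsol t (interior_subset ht)).hasDerivAt_energy.hasDerivWithinAt
      · have := (hy t (interior_subset ht)).ne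
        positivity
    have hlim : Tendsto (energy c α z₀ y₀) atTop (𝓝 0) := by
      have hV : Continuous (potential c α) := by unfold potential; fun_prop
      have := ((hy0.pow 2).div_const 2).sub ((hV.tendsto 0).comp hz0)
      have h0 : (0 : ℝ) ^ 2 / 2 - potential c α 0 = 0 := by simp [potential]
      rw [h0] at this
      exact this
    intro t ht
    -- The detour through `t + 1` keeps the inequality strict, since the limit only yields `≤ 0`.
    have h1 : energy c α z₀ y₀ t < energy c α z₀ y₀ (t + 1) :=
      hmono ht (by simp only [Set.mem_Ici]; linarith) (by linarith)
    have h2 : energy c α z₀ y₀ (t + 1) ≤ 0 := by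
      refine ge_of_tendsto hlim ?_
      filter_upwards [eventually_ge_atTop (t + 1)] with s hs
      exact hmono.monotoneOn (by simp only [Set.mem_Ici]; linarith)
        (by simp only [Set.mem_Ici]; linarith) hs
    linarith
  obtain ⟨K, hK⟩ := exists_lipschitzWith_truncField (k := k) hc hα
  obtain ⟨L, hL⟩ := exists_norm_truncField_le (k := k) hc hα
  obtain ⟨γ, hγT, hγ⟩ := exists_global_solution hK hL T (z₀ T, y₀ T)
  have hγ₀ : ∀ t ≥ T, HasDerivAt (fun t => (z₀ t, y₀ t)) (truncField k c α (z₀ t, y₀ t)) t := by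
    intro t ht
    obtain ⟨h1, h2⟩ := bounds_of_energy_neg hc hα (hz t ht) (hE0 t ht)
    rw [truncField_eq (hz t ht) h1 h2]
    exact (hsol t ht).1.prodMk (hsol t ht).2
  have heq : ∀ t ≥ T, γ t = (z₀ t, y₀ t) := by
    intro t ht
    exact ODE_solution_unique (v := fun _ => truncField k c α) (fun _ => hK)
      (HasDerivAt.continuousOn fun s _ => hγ s) (fun s _ => (hγ s).hasDerivWithinAt)
      (HasDerivAt.continuousOn fun s hs => hγ₀ s hs.1)
      (fun s hs => (hγ₀ s hs.1).hasDerivWithinAt) hγT ⟨ht, le_rfl⟩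
  -- Compare with the time `max t T`, where the orbit is the given one and its energy is known to be
  -- negative. Hence the orbit never meets the truncation.
  have hEγ : ∀ t, truncKinetic c α (γ t).2 - truncPotential c α (γ t).1 < 0 := by
    intro t
    have hT := le_max_right t T
    refine (monotone_truncEnergy hk hγ (le_max_left t T)).trans_lt ?_
    obtain ⟨h1, h2⟩ := bounds_of_energy_neg hc hα (hz _ hT) (hE0 _ hT)
    simp only [heq _ hT]
    rw [truncKinetic_of_abs_le h2.le, truncPotential_of_mem ⟨(hz _ hT).le, h1.le⟩]
    exact hE0 _ hT
  refine ⟨fun t => (γ t).1, fun t => (γ t).2, fun t => ?_, fun t => ?_, fun t => ?_, fun t ht => ?_⟩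
  · obtain ⟨h0, h1, h2⟩ := bounds_of_truncEnergy_neg hc hα (hEγ t)
    have h := hγ t
    rw [truncField_eq h0 h1 h2] at h
    exact ⟨h.fst, h.snd⟩
  · exact (bounds_of_truncEnergy_neg hc hα (hEγ t)).1
  · obtain ⟨h0, h1, h2⟩ := bounds_of_truncEnergy_neg hc hα (hEγ t)
    have h := hEγ t
    rwa [truncKinetic_of_abs_le h2.le, truncPotential_of_mem ⟨h0.le, h1.le⟩] at h
  · simp [heq t ht]

/-- A global positive solution of negative energy emanates from the equilibrium `(c / α, 0)`. -/
lemma tendsto_atBot_of_energy_neg {k c α : ℝ} (hk : 0 < k) (hc : 0 < c) (hα : 0 < α)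
    {z y : ℝ → ℝ} (hsol : ∀ t, SolvesAt k c α z y t) (hz : ∀ t, 0 < z t)
    (hE : ∀ t, energy c α z y t < 0) :
    Tendsto z atBot (𝓝 (c / α)) ∧ Tendsto y atBot (𝓝 0) := by
  have hbd := fun t => bounds_of_energy_neg hc hα (hz t) (hE t)
  set R := potentialZero c α
  set Y := speedBound c α
  have hR : 0 < R := potentialZero_pos hc hα
  have hY : 0 < Y := speedBound_pos hc hα
  have hmono : Monotone (energy c α z y) :=
    monotone_of_hasDerivAt_nonneg (fun t => (hsol t).hasDerivAt_energy) fun t => by positivity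
  obtain ⟨l, hl⟩ : ∃ l, Tendsto (energy c α z y) atBot (𝓝 l) := by
    refine ⟨_, tendsto_atBot_ciInf hmono ⟨-(Y ^ 2 / 2), ?_⟩⟩
    rintro _ ⟨t, rfl⟩
    have := potential_lt hc hα (hz t) (hbd t).1
    simp only [energy]
    linarith [sq_nonneg (y t)]
  have hreact : ∀ t, |reaction c α (z t)| ≤ c * R + α * R ^ 2 := by
    intro t
    have h0 := (hz t).le
    have h1 := (hbd t).1.le
    have h2 : c * z t ≤ c * R := by gcongr
    have h3 : α * z t ^ 2 ≤ α * R ^ 2 := by gcongr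
    have h4 : 0 ≤ c * z t := by positivity
    have h5 : 0 ≤ α * z t ^ 2 := by positivity
    rw [reaction, abs_le]
    constructor <;> linarith
  have hacc : ∀ t, |k * y t + reaction c α (z t)| ≤ k * Y + (c * R + α * R ^ 2) := by
    intro t
    refine (abs_add_le _ _).trans (add_le_add ?_ (hreact t))
    rw [abs_mul, abs_of_pos hk]
    have := (hbd t).2.le
    gcongr
  set A := k * Y + (c * R + α * R ^ 2)
  have hA : 0 ≤ A := by positivity
  -- Barbalat for the energy: it converges and its second derivative is bounded.
  have hysq : Tendsto (fun t => k * y t ^ 2) atBot (𝓝 0) := by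
    refine tendsto_deriv_atBot_of_tendsto (fun t => (hsol t).hasDerivAt_energy)
      (h := fun t => k * (2 * y t * (k * y t + reaction c α (z t)))) (C := k * (2 * Y * A))
      (fun t => ?_) (fun t => ?_) hl
    · refine (((hsol t).2.pow 2).const_mul k).congr_deriv ?_
      push_cast
      ring
    · rw [abs_mul, abs_mul, abs_mul, abs_of_pos hk, abs_two]
      have := (hbd t).2.le
      have := hacc t
      gcongr
  have hy0 : Tendsto y atBot (𝓝 0) := by
    have h1 := hysq.const_mul k⁻¹
    simp only [inv_mul_cancel_left₀ hk.ne', mul_zero] at h1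
    have h2 := h1.sqrt
    simp only [Real.sqrt_sq_eq_abs, Real.sqrt_zero] at h2
    exact (tendsto_zero_iff_abs_tendsto_zero _).mpr h2
  refine ⟨?_, hy0⟩
  -- Barbalat again, now for `y`. It follows that the reaction tends to zero, so only the two
  -- equilibria remain as candidates.
  have hy' : Tendsto (fun t => k * y t + reaction c α (z t)) atBot (𝓝 0) := by
    refine tendsto_deriv_atBot_of_tendsto (fun t => (hsol t).2)
      (h := fun t => k * (k * y t + reaction c α (z t)) + (c - 2 * α * z t) * y t)
      (C := k * A + (c + 2 * α * R) * Y) (fun t => ?_) (fun t => ?_) hy0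
    · have := ((hsol t).2.const_mul k).add
        (((hsol t).1.const_mul c).sub (((hsol t).1.pow 2).const_mul α))
      refine this.congr_deriv ?_
      push_cast
      ring
    · refine (abs_add_le _ _).trans ?_
      rw [abs_mul, abs_mul, abs_of_pos hk]
      have h1 := hacc t
      have h2 := (hbd t).2.le
      have h3 : |c - 2 * α * z t| ≤ c + 2 * α * R := by
        have h4 : 2 * α * z t ≤ 2 * α * R := mul_le_mul_of_nonneg_left (hbd t).1.le (by positivity)
        have h5 : 0 < 2 * α * z t := mul_pos (by positivity) (hz t)
        rw [abs_le]
        constructor <;> linarith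
      gcongr
  have hreact0 : Tendsto (fun t => reaction c α (z t)) atBot (𝓝 0) := by
    have := hy'.sub (hy0.const_mul k)
    simpa using this
  -- For `t ≤ 0` the energy is at most its negative value at `0`, so `c * z^2 / 2 ≥ -E(0)`. This
  -- lower bound on `z` excludes the origin as a limit.
  set m := Real.sqrt (2 * -energy c α z y 0 / c)
  have hm : 0 < m := Real.sqrt_pos.mpr (div_pos (by linarith [hE 0]) hc)
  have hzm : ∀ t ≤ 0, m ≤ z t := by
    intro t ht
    refine Real.sqrt_le_iff.mpr ⟨(hz t).le, ?_⟩
    rw [div_le_iff₀ hc]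
    have h1 := hmono ht
    have h2 : energy c α z y t = y t ^ 2 / 2 - (c * z t ^ 2 / 2 - α * z t ^ 3 / 3) := rfl
    have h3 : 0 < α * z t ^ 3 := mul_pos hα (pow_pos (hz t) 3)
    linarith [sq_nonneg (y t)]
  have hfac : Tendsto (fun t => c - α * z t) atBot (𝓝 0) := by
    have h1 := hreact0.abs.div_const m
    rw [abs_zero, zero_div] at h1
    refine squeeze_zero_norm' ?_ h1
    filter_upwards [eventually_le_atBot 0] with t ht
    rw [le_div_iff₀ hm, show reaction c α (z t) = (c - α * z t) * z t by unfold reaction; ring,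
      abs_mul, abs_of_pos (hz t), Real.norm_eq_abs]
    have := hzm t ht
    gcongr
  have := (hfac.const_sub c).div_const α
  simp only [sub_sub_cancel, sub_zero, mul_div_cancel_left₀ _ hα.ne'] at this
  exact this

/-! ### Linearization of the planar field -/

lemma hasFDerivAt_planarField (N : ℕ) (p : ℝ × ℝ) :
    HasFDerivAt (planarField N) (LinearMap.toContinuousLinearMap
      (Matrix.toLin (Module.Basis.finTwoProd ℝ) (Module.Basis.finTwoProd ℝ)
        !![0, 1; 2 * (N : ℝ) - 4 - 2 * alphaTwo N * p.1, (N : ℝ) - 4])) p := by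
  rw [Matrix.toLin_finTwoProd_toContinuousLinearMap]
  have h1 : HasFDerivAt (fun q : ℝ × ℝ => q.1) (ContinuousLinearMap.fst ℝ ℝ ℝ) p := hasFDerivAt_fst
  have h2 : HasFDerivAt (fun q : ℝ × ℝ => q.2) (ContinuousLinearMap.snd ℝ ℝ ℝ) p := hasFDerivAt_snd
  have := h2.prodMk (((h2.const_mul ((N : ℝ) - 4)).add (h1.const_mul (2 * (N : ℝ) - 4))).sub
    ((h1.pow 2).const_mul (alphaTwo N)))
  refine this.congr_fderiv ?_
  ext <;> simp
  ring

lemma linCharpoly_planarField (N : ℕ) (p : ℝ × ℝ) : linCharpoly (planarField N) p =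
    X ^ 2 - C ((N : ℝ) - 4) * X - C (2 * (N : ℝ) - 4 - 2 * alphaTwo N * p.1) := by
  rw [linCharpoly, (hasFDerivAt_planarField N p).fderiv, LinearMap.coe_toContinuousLinearMap,
    Matrix.charpoly_toLin, Matrix.charpoly_fin_two]
  simp [Matrix.trace_fin_two, Matrix.det_fin_two]
  ring

lemma isEquilibrium_zero (N : ℕ) : IsEquilibrium (planarField N) (0, 0) :=
  ⟨by simp [planarField], (hasFDerivAt_planarField N _).differentiableAt⟩

lemma isEquilibrium_gammaOne {N : ℕ} (hN : 4 < N) :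
    IsEquilibrium (planarField N) (gammaOne N) := by
  refine ⟨?_, (hasFDerivAt_planarField N _).differentiableAt⟩
  have := (alphaTwo_pos hN).ne'
  ext
  · simp [planarField, gammaOne]
  · simp only [planarField, gammaOne, Prod.snd_zero]
    field_simp
    ring

lemma isSaddle_zero {N : ℕ} (hN : 4 < N) : IsSaddle (planarField N) (0, 0) := by
  have hN' : (4 : ℝ) < N := by exact_mod_cast hN
  refine ⟨isEquilibrium_zero N, -2, N - 2, by norm_num, by linarith, ?_⟩
  rw [linCharpoly_planarField]
  simp only [mul_zero, sub_zero, map_sub, map_mul, map_neg, map_ofNat]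
  ring

lemma linCharpoly_gammaOne {N : ℕ} (hN : 4 < N) : linCharpoly (planarField N) (gammaOne N) =
    X ^ 2 - C ((N : ℝ) - 4) * X + C (2 * (N : ℝ) - 4) := by
  have : 2 * (N : ℝ) - 4 - 2 * alphaTwo N * (gammaOne N).1 = -(2 * (N : ℝ) - 4) := by
    have := (alphaTwo_pos hN).ne'
    simp only [gammaOne]
    field_simp
    ring
  rw [linCharpoly_planarField, this, map_neg, sub_neg_eq_add]

lemma isSource_gammaOne {N : ℕ} (hN : 4 < N) : IsSource (planarField N) (gammaOne N) := by
  have hN' : (4 : ℝ) < N := by exact_mod_cast hN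
  refine ⟨isEquilibrium_gammaOne hN, fun μ hμ => ?_⟩
  rw [linCharpoly_gammaOne hN] at hμ
  simp only [map_add, map_sub, map_mul, map_pow, aeval_X, aeval_C] at hμ
  have hre := congrArg Complex.re hμ
  have him := congrArg Complex.im hμ
  simp [sq] at hre him
  have him' : μ.im * (2 * μ.re - (N - 4)) = 0 := by linarith
  -- A real root cannot be nonpositive because of the signs of the coefficients; a nonreal one has
  -- real part `(N - 4) / 2`.
  rcases mul_eq_zero.mp him' with h | h
  · rw [h] at hre
    by_contra! hcon
    nlinarith [mul_nonneg (sub_nonneg.mpr hN'.le) (neg_nonneg.mpr hcon), mul_self_nonneg μ.re]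
  · linarith

lemma isUnstableNode_gammaOne_iff {N : ℕ} (hN : 4 < N) :
    IsUnstableNode (planarField N) (gammaOne N) ↔ 14 ≤ N := by
  have hN' : (4 : ℝ) < N := by exact_mod_cast hN
  rw [IsUnstableNode, linCharpoly_gammaOne hN]
  constructor
  · rintro ⟨-, a, b, -, -, hab⟩
    have ha := congrArg (Polynomial.eval a) hab
    have hb := congrArg (Polynomial.eval 0) hab
    have h1 := congrArg (Polynomial.eval 1) hab
    simp at ha hb h1
    by_contra! hlt
    have h13 : (N : ℝ) ≤ 13 := by exact_mod_cast (by omega : N ≤ 13)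
    -- At a real root, `(2 a - (N - 4))^2` equals the discriminant `N^2 - 16 N + 32`, which is
    -- negative for `4 < N ≤ 13`.
    nlinarith [sq_nonneg (2 * a - (N - 4)), mul_nonneg (sub_nonneg.mpr hN'.le) (sub_nonneg.mpr h13)]
  · intro h14
    have h14' : (14 : ℝ) ≤ N := by exact_mod_cast h14
    set D : ℝ := ((N : ℝ) - 4) ^ 2 - 4 * (2 * N - 4) with hD
    have hD0 : 0 ≤ D := by nlinarith
    have hs := Real.sq_sqrt hD0
    have hlt : Real.sqrt D < N - 4 := by
      rw [Real.sqrt_lt' (by linarith)]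
      linarith
    refine ⟨isEquilibrium_gammaOne hN, ((N : ℝ) - 4 - Real.sqrt D) / 2,
      ((N : ℝ) - 4 + Real.sqrt D) / 2, by linarith, by linarith [Real.sqrt_nonneg D], ?_⟩
    have hsum : (N : ℝ) - 4 = ((N : ℝ) - 4 - Real.sqrt D) / 2 + ((N : ℝ) - 4 + Real.sqrt D) / 2 := by
      ring
    have hprod : 2 * (N : ℝ) - 4 =
        ((N : ℝ) - 4 - Real.sqrt D) / 2 * (((N : ℝ) - 4 + Real.sqrt D) / 2) := by
      linarith
    rw [congrArg C hprod, congrArg C hsum, map_add, map_mul]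
    ring

/-! ### Cardinality of sets of continuous functions -/

/-- A set of continuous real functions has at most the cardinality of the continuum. -/
lemma mk_le_continuum_of_continuous (S : Set (ℝ → ℝ)) (hS : ∀ f ∈ S, Continuous f) :
    Cardinal.mk S ≤ Cardinal.continuum := by
  -- A continuous function is determined by its values on the dense set `ℚ`, and `ℚ → ℝ` has the
  -- cardinality of the continuum.
  have hinj : Function.Injective fun (f : S) (q : ℚ) => (f : ℝ → ℝ) q := by
    intro f g hfg
    refine Subtype.ext ((hS f f.2).ext_on Rat.isDenseEmbedding_coe_real.dense (hS g g.2) ?_)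
    rintro _ ⟨q, rfl⟩
    exact congrFun hfg q
  refine (Cardinal.mk_le_of_injective hinj).trans ?_
  simp [Cardinal.mk_real]

/-! ### The connecting orbit and its translates -/

/-- The planar system has a positive orbit connecting `γ₁` to the origin which decays like
`exp (-2 t)` and is eventually strictly decreasing. -/
lemma exists_connecting_orbit {N : ℕ} (hN : 4 < N) : ∃ z y : ℝ → ℝ,
    (∀ t, SolvesAt ((N : ℝ) - 4) (2 * N - 4) (alphaTwo N) z y t) ∧ (∀ t, 0 < z t) ∧
    Tendsto z atBot (𝓝 ((2 * N - 4) / alphaTwo N)) ∧ Tendsto y atBot (𝓝 0) ∧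
    Tendsto z atTop (𝓝 0) ∧ Tendsto y atTop (𝓝 0) ∧
    Tendsto (fun t => Real.exp (2 * t) * z t) atTop (𝓝 1) ∧ ∃ T, ∀ t ≥ T, y t < 0 := by
  have hN' : (4 : ℝ) < N := by exact_mod_cast hN
  have hk : (0 : ℝ) < N - 4 := by linarith
  have hc : (0 : ℝ) < 2 * N - 4 := by linarith
  have hα := alphaTwo_pos hN
  have hexp : Tendsto (fun t : ℝ => Real.exp (-(2 * t))) atTop (𝓝 0) :=
    Real.tendsto_exp_neg_atTop_nhds_zero.comp (tendsto_id.const_mul_atTop two_pos)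
  have hlim : ∀ j, Tendsto (stableSeries N j) atTop (𝓝 0) := by
    intro j
    have := hexp.mul (tendsto_exp_mul_stableSeries hN j)
    rw [zero_mul] at this
    refine this.congr fun t => ?_
    rw [← mul_assoc, ← Real.exp_add, neg_add_cancel, Real.exp_zero, one_mul]
  have h0 := tendsto_exp_mul_stableSeries hN 0
  have h1 := tendsto_exp_mul_stableSeries hN 1
  rw [pow_zero] at h0
  rw [pow_one] at h1
  have hev := (eventually_gt_atTop (0 : ℝ)).and ((h0.eventually_const_lt one_pos).and
    (h1.eventually_lt_const (by norm_num : (-2 : ℝ) < 0)))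
  obtain ⟨T, hT⟩ := eventually_atTop.mp hev
  have hzpos : ∀ t ≥ T, 0 < stableSeries N 0 t := fun t ht =>
    (mul_pos_iff_of_pos_left (Real.exp_pos _)).mp (hT t ht).2.1
  have hyneg : ∀ t ≥ T, stableSeries N 1 t < 0 := fun t ht =>
    (pos_iff_neg_of_mul_neg (hT t ht).2.2).mp (Real.exp_pos _)
  have hsol : ∀ t ≥ T, SolvesAt ((N : ℝ) - 4) (2 * N - 4) (alphaTwo N)
      (stableSeries N 0) (stableSeries N 1) t := by
    intro t ht
    refine ⟨hasDerivAt_stableSeries hN 0 (hT t ht).1,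
      (hasDerivAt_stableSeries hN 1 (hT t ht).1).congr_deriv ?_⟩
    rw [stableSeries_eqn hN (hT t ht).1, reaction]
    ring
  obtain ⟨z, y, hzy, hz, hE, heq⟩ :=
    exists_backward_extension hk hc hα hsol hzpos hyneg (hlim 0) (hlim 1)
  obtain ⟨hzb, hyb⟩ := tendsto_atBot_of_energy_neg hk hc hα hzy hz hE
  have heqz : ∀ᶠ t in atTop, stableSeries N 0 t = z t :=
    (eventually_ge_atTop T).mono fun t ht => (heq t ht).1.symm
  have heqy : ∀ᶠ t in atTop, stableSeries N 1 t = y t :=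
    (eventually_ge_atTop T).mono fun t ht => (heq t ht).2.symm
  exact ⟨z, y, hzy, hz, hzb, hyb, (hlim 0).congr' heqz, (hlim 1).congr' heqy,
    h0.congr' (heqz.mono fun t ht => by rw [ht]), T, fun t ht => (heq t ht).2 ▸ hyneg t ht⟩

section translates

variable {k c α : ℝ} {z y : ℝ → ℝ}

lemma deriv_eq_of_solvesAt (h : ∀ t, SolvesAt k c α z y t) : deriv z = y :=
  funext fun t => (h t).1.deriv

lemma contDiff_two_of_solvesAt (h : ∀ t, SolvesAt k c α z y t) : ContDiff ℝ 2 z := by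
  have hz : Continuous z := continuous_iff_continuousAt.mpr fun t => (h t).1.continuousAt
  have hy : Continuous y := continuous_iff_continuousAt.mpr fun t => (h t).2.continuousAt
  have hdy : deriv y = fun t => k * y t + reaction c α (z t) := funext fun t => (h t).2.deriv
  rw [show (2 : WithTop ℕ∞) = 1 + 1 by norm_num, contDiff_succ_iff_deriv, deriv_eq_of_solvesAt h,
    contDiff_one_iff_deriv, hdy]
  refine ⟨fun t => (h t).1.differentiableAt, by simp, fun t => (h t).2.differentiableAt, ?_⟩
  unfold reaction
  fun_prop

lemma solvesAt_comp_add (h : ∀ t, SolvesAt k c α z y t) (s t : ℝ) :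
    SolvesAt k c α (fun t => z (t + s)) (fun t => y (t + s)) t :=
  ⟨(h (t + s)).1.comp_add_const t s, (h (t + s)).2.comp_add_const t s⟩

end translates

lemma isEntireSolution_of_solvesAt {N : ℕ} {z y : ℝ → ℝ}
    (h : ∀ t, SolvesAt ((N : ℝ) - 4) (2 * N - 4) (alphaTwo N) z y t)
    (hbot : Tendsto (fun t => Real.exp t * z t) atBot (𝓝 0))
    (htop : Tendsto (fun t => Real.exp t * z t) atTop (𝓝 0)) : IsEntireSolution N z := by
  refine ⟨contDiff_two_of_solvesAt h, fun t => ?_, hbot, htop⟩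
  rw [deriv_eq_of_solvesAt h, (h t).2.deriv, reaction]
  ring

lemma isEntireSolutionW_of_solvesAt {N : ℕ} {z y : ℝ → ℝ}
    (h : ∀ t, SolvesAt ((N : ℝ) - 4) (2 * N - 4) (alphaTwo N) z y t)
    (hbot : Tendsto (fun t => Real.exp t * z t) atBot (𝓝 0))
    (htop : Tendsto (fun t => Real.exp t * z t) atTop (𝓝 0)) :
    IsEntireSolutionW N (fun t => Real.exp t * z t) := by
  have hd1 : deriv (fun t => Real.exp t * z t) =
      fun t => Real.exp t * z t + Real.exp t * y t :=
    funext fun t => ((Real.hasDerivAt_exp t).mul (h t).1).deriv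
  refine ⟨Real.contDiff_exp.mul (contDiff_two_of_solvesAt h), fun t => ?_, hbot, htop⟩
  have hd2 := (((Real.hasDerivAt_exp t).fun_mul (h t).1).fun_add
    ((Real.hasDerivAt_exp t).fun_mul (h t).2)).deriv
  have hexp : Real.exp (-t) * Real.exp t = 1 := by rw [← Real.exp_add]; simp
  have hquad : alphaTwo N * Real.exp (-t) * (Real.exp t * z t) ^ 2 =
      alphaTwo N * Real.exp t * z t ^ 2 := by
    linear_combination alphaTwo N * Real.exp t * z t ^ 2 * hexp
  rw [hd1, hd2, hquad, reaction]
  ring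

theorem theorem3p6 (N : ℕ) (hN : 4 < N) :
    Cardinal.mk (positiveEntireSolutions N) = Cardinal.continuum ∧
    IsSaddle (planarField N) (0, 0) ∧
    IsSource (planarField N) (gammaOne N) ∧
    (IsUnstableNode (planarField N) (gammaOne N) ↔ 14 ≤ N) ∧
    ∃ z : ℝ → ℝ,
      IsHeteroclinic (planarField N) (gammaOne N) (0, 0) (fun t => (z t, deriv z t)) ∧
      (∃ c : ℝ, 0 < c ∧ Tendsto (fun t : ℝ => Real.exp (2 * t) * z t) atTop (𝓝 c)) ∧
      (∀ s : ℝ, (fun t => z (t + s)) ∈ positiveEntireSolutions N ∧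
        IsEntireSolutionW N (fun t => Real.exp t * z (t + s))) ∧
      Function.Injective (fun (s : ℝ) (t : ℝ) => z (t + s)) := by
  obtain ⟨z, y, hsol, hz, hzb, hyb, hzt, hyt, hdecay, T, hT⟩ := exists_connecting_orbit hN
  have hinj : Function.Injective (fun (s : ℝ) (t : ℝ) => z (t + s)) := by
    have hanti : StrictAntiOn z (Set.Ici T) :=
      strictAntiOn_of_hasDerivWithinAt_neg (convex_Ici T)
        (HasDerivAt.continuousOn fun t _ => (hsol t).1)
        (fun t _ => (hsol t).1.hasDerivWithinAt) fun t ht => hT t (interior_subset ht)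
    intro s s' hss
    -- At this time both shifted arguments lie in `[T, ∞)`, where `z` is strictly decreasing.
    have h := congrFun hss (T + |s| + |s'|)
    have := hanti.injOn (x₁ := T + |s| + |s'| + s) (x₂ := T + |s| + |s'| + s')
      (Set.mem_Ici.mpr (by linarith [neg_abs_le s, abs_nonneg s']))
      (Set.mem_Ici.mpr (by linarith [neg_abs_le s', abs_nonneg s])) h
    linarith
  have hbot : ∀ s, Tendsto (fun t => Real.exp t * z (t + s)) atBot (𝓝 0) := fun s => by
    have := Real.tendsto_exp_atBot.mul (hzb.comp (tendsto_atBot_add_const_right _ s tendsto_id))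
    rwa [zero_mul] at this
  have htop : ∀ s, Tendsto (fun t => Real.exp t * z (t + s)) atTop (𝓝 0) := fun s => by
    -- The decay `exp (-2 t)` beats the weight `exp t`, leaving a spare factor `exp (-t)`.
    have h1 := (hdecay.comp (tendsto_atTop_add_const_right _ s tendsto_id)).mul
      (Real.tendsto_exp_neg_atTop_nhds_zero.const_mul (Real.exp (-(2 * s))))
    rw [mul_zero, mul_zero] at h1
    refine h1.congr fun t => ?_
    have : Real.exp t = Real.exp (2 * (t + s)) * (Real.exp (-(2 * s)) * Real.exp (-t)) := by
      rw [← Real.exp_add, ← Real.exp_add]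
      ring_nf
    simp only [Function.comp, id]
    rw [this]
    ring
  have hmem : ∀ s : ℝ, (fun t => z (t + s)) ∈ positiveEntireSolutions N := fun s =>
    ⟨isEntireSolution_of_solvesAt (solvesAt_comp_add hsol s) (hbot s) (htop s),
      fun h => (hz (0 + s)).ne' (congrFun h 0), fun t => hz (t + s)⟩
  refine ⟨le_antisymm ?_ ?_, isSaddle_zero hN, isSource_gammaOne hN,
    isUnstableNode_gammaOne_iff hN, z, ⟨?_, isEquilibrium_gammaOne hN, isEquilibrium_zero N,
      fun t => ?_, ?_, ?_⟩, ⟨1, one_pos, hdecay⟩, fun s => ⟨hmem s,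
        isEntireSolutionW_of_solvesAt (solvesAt_comp_add hsol s) (hbot s) (htop s)⟩, hinj⟩
  · exact mk_le_continuum_of_continuous _ fun f hf => hf.1.contDiff.continuous
  · rw [← Cardinal.mk_real]
    exact Cardinal.mk_le_of_injective (f := fun s => ⟨fun t => z (t + s), hmem s⟩)
      fun s s' h => hinj (congrArg Subtype.val h)
  · intro h
    have hN' : (4 : ℝ) < N := by exact_mod_cast hN
    have := congrArg Prod.fst h
    exact (div_pos (by linarith) (alphaTwo_pos hN)).ne' this
  · rw [deriv_eq_of_solvesAt hsol]
    refine ((hsol t).1.prodMk (hsol t).2).congr_deriv ?_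
    simp only [planarField, reaction]
    ring_nf
  · rw [deriv_eq_of_solvesAt hsol]
    exact hzb.prodMk_nhds hyb
  · rw [deriv_eq_of_solvesAt hsol]
    exact hzt.prodMk_nhds hyt

end
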